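/- Let $d\in\{2,3\}$ and let $\Omega\subset\mathbb R^d$ be a bounded simply connected Lipschitz domain. Let $E>0$, $t>0$, $-1<\nu\le \tfrac12$, with $1+(d-1)\nu>0$ (which is automatic for $d=2$), and let $\mathcal C$ be the symmetric positive definite map on symmetric $d\times d$ tensors $$\mathcal C\kappa = D\,[\nu\,\mathrm{tr}(\kappa) I+(1-\nu)\kappa],\qquad D=\frac{Et^3}{12(1-\nu^2)}.$$ Write $(\cdot,\cdot)_\omega$ and $\|\cdot\|_\omega$ for the inner product and norm of $L_2(\omega)$ (scalar or tensor valued; Frobenius product), dropping $\omega=\Omega$; $\mathbb L_2^s(\Omega)$ is the space of symmetric tensor functions with components in $L_2(\Omega)$, and $\varepsilon\nabla z$ is the symmetrized gradient of $\nabla z$, i.e. the Hessian of $z$. A mesh $\mathcal T$ of $\Omega$ is a finite set of pairwise disjoint open Lipschitz subsets $T\subset\Omega$ (elements) that cover $\Omega$ up to a null set. Define $H^2(\mathcal T)=\{z\in L_2(\Omega):\ z|_T\in H^2(T)\ \forall T\in\mathcal T\}$, let $\varepsilon_{\mathcal T}\nabla_{\mathcal T}z\in\mathbb L_2^s(\Omega)$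 be the piecewise Hessian of $z\in H^2(\mathcal T)$, and put $\|z\|_{2,\mathcal T}^2=\|z\|^2+\|\varepsilon_{\mathcal T}\nabla_{\mathcal T}z\|^2$. Let $H^2_0(\Omega)$ be the closure of $\mathcal D(\Omega)=C_c^\infty(\Omega)$ in the norm $(\|z\|^2+\|\varepsilon\nabla z\|^2)^{1/2}$, and let $H(\mathrm{div}\,\mathbf{div},\Omega)$ be the space of $\Theta\in\mathbb L_2^s(\Omega)$ whose twice iterated distributional divergence $\mathrm{div}\,\mathbf{div}\,\Theta$ is in $L_2(\Omega)$. For $\Theta\in H(\mathrm{div}\,\mathbf{div},\Omega)$ let $\mathrm{tr}(\Theta)\in H^2(\mathcal T)'$ be the functional $$\langle \mathrm{tr}(\Theta),z\rangle_{\mathcal S}=\sum_{T\in\mathcal T}\big[(\mathrm{div}\,\mathbf{div}\,\Theta,z)_T-(\Theta,\varepsilon\nabla z)_T\big],\qquad z\in H^2(\mathcal T),$$ let $\mathbf H^{-3/2,-1/2}(\mathcal S)=\mathrm{tr}\big(H(\mathrm{div}\,\mathbf{div},\Omega)\big)$ with norm $\|q\|_{-3/2,-1/2,\mathcal S}=\sup_{0\ne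 z\in H^2(\mathcal T)}\langle q,z\rangle_{\mathcal S}/\|z\|_{2,\mathcal T}$, and for $z\in H^2(\mathcal T)$ define the jump $[z,\nabla_{\mathcal T}z]\in \mathbf H^{-3/2,-1/2}(\mathcal S)'$ by $q\mapsto\langle q,z\rangle_{\mathcal S}$, with $$\|[z,\nabla_{\mathcal T}z]\|_{(-3/2,-1/2,\mathcal S)'}=\sup_{0\ne q\in \mathbf H^{-3/2,-1/2}(\mathcal S)}\frac{\langle q,z\rangle_{\mathcal S}}{\|q\|_{-3/2,-1/2,\mathcal S}}.$$ Finally let $P:\mathbb L_2^s(\Omega)\to\mathcal C\varepsilon\nabla H^2_0(\Omega)$ be the orthogonal projection: $(P(\Theta),\mathcal C\varepsilon\nabla\delta z)=(\Theta,\mathcal C\varepsilon\nabla\delta z)$ for all $\delta z\in H^2_0(\Omega)$. Then there is a constant $c>0$, depending only on $\Omega$ and $\mathcal C$, such that for every mesh $\mathcal T$ of $\Omega$ $$\|z\|_{2,\mathcal T}\le c\,\Big(\|P(\varepsilon_{\mathcal T}\nabla_{\mathcal T}z)\|+\|[z,\nabla_{\mathcal T}z]\|_{(-3/2,-1/2,\mathcal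 S)'}\Big)\qquad\forall z\in H^2(\mathcal T).$$ -/

import Mathlib

open MeasureTheory TopologicalSpace
open scoped ENNReal Topology ContDiff Distributions

noncomputable section

namespace PlateDPG

/-! ### Tensors and the material law -/

/-- The Euclidean space `ℝ^d`. -/
abbrev Pt (d : ℕ) : Type := EuclideanSpace ℝ (Fin d)

/-- The symmetric `d × d` tensors, as a subspace of all tensors with the Frobenius inner product. -/
def symTensors (d : ℕ) : Submodule ℝ (EuclideanSpace ℝ (Fin d × Fin d)) where
  carrier := {κ | ∀ i j, κ (i, j) = κ (j, i)}
  add_mem' := by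
    intro a b ha hb i j
    simp [ha i j, hb i j]
  zero_mem' := by
    intro i j
    simp
  smul_mem' := by
    intro c a ha i j
    simp [ha i j]

/-- The inner product space of symmetric `d × d` tensors (Frobenius inner product). -/
def SymTensor (d : ℕ) : Type := symTensors d

instance (d : ℕ) : NormedAddCommGroup (SymTensor d) :=
  inferInstanceAs (NormedAddCommGroup (symTensors d))

instance (d : ℕ) : InnerProductSpace ℝ (SymTensor d) :=
  inferInstanceAs (InnerProductSpace ℝ (symTensors d))

instance (d : ℕ) : FiniteDimensional ℝ (SymTensor d) :=
  inferInstanceAs (FiniteDimensional ℝ (symTensors d))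

instance (d : ℕ) : CompleteSpace (SymTensor d) := FiniteDimensional.complete ℝ _

/-- The entry `κ_{ij}` of a symmetric tensor. -/
def entry {d : ℕ} (i j : Fin d) : SymTensor d →L[ℝ] ℝ :=
  (EuclideanSpace.proj (i, j)).comp (symTensors d).subtypeL

lemma SymTensor.ext_entry {d : ℕ} {κ κ' : SymTensor d} (h : ∀ i j, entry i j κ = entry i j κ') :
    κ = κ' := by
  apply Subtype.ext
  ext p
  exact h p.1 p.2

/-- The identity tensor. -/
def idTensor (d : ℕ) : SymTensor d :=
  ⟨WithLp.toLp 2 (fun p => if p.1 = p.2 then 1 else 0), by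
    intro i j
    simp [eq_comm]⟩

/-- The trace of a symmetric tensor. -/
def trTensor (d : ℕ) : SymTensor d →L[ℝ] ℝ :=
  ∑ i, entry i i

/-- The bending rigidity `D = E t³ / (12 (1 - ν²))`. -/
def rigidity (E t ν : ℝ) : ℝ := E * t ^ 3 / (12 * (1 - ν ^ 2))

/-- The material tensor `𝒞 κ = D (ν tr(κ) I + (1 - ν) κ)`. -/
def stiffness (d : ℕ) (E t ν : ℝ) : SymTensor d →L[ℝ] SymTensor d :=
  rigidity E t ν •
    (ν • (trTensor d).smulRight (idTensor d) + (1 - ν) • ContinuousLinearMap.id ℝ (SymTensor d))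

/-! ### Lipschitz sets and meshes -/

/-- A bounded open set with Lipschitz boundary: near each boundary point and in suitable Cartesian
coordinates (with `e` the last coordinate direction) it is the strict epigraph of a Lipschitz
function `γ` of the other coordinates. -/
def IsBoundedLipschitz {d : ℕ} (U : Opens (Pt d)) : Prop :=
  Bornology.IsBounded (U : Set (Pt d)) ∧
  ∀ p ∈ frontier (U : Set (Pt d)),
    ∃ e : Pt d, ‖e‖ = 1 ∧ ∃ (K : NNReal) (γ : ((ℝ ∙ e)ᗮ : Submodule ℝ (Pt d)) → ℝ),
      LipschitzWith K γ ∧ ∃ N ∈ 𝓝 p, ∀ x ∈ N,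
        (x ∈ U ↔ γ ((ℝ ∙ e)ᗮ.orthogonalProjectionOnto x) < inner ℝ e x)

/-- A mesh of `Ω`: finitely many pairwise disjoint (open) Lipschitz elements contained in `Ω` that
cover `Ω` up to a null set (the skeleton). -/
structure Mesh {d : ℕ} (Ω : Opens (Pt d)) where
  elements : Finset (Opens (Pt d))
  lipschitz : ∀ T ∈ elements, IsBoundedLipschitz T
  subset : ∀ T ∈ elements, T ≤ Ω
  disjoint : ∀ T ∈ elements, ∀ T' ∈ elements, T ≠ T' → Disjoint (T : Set (Pt d)) (T' : Set (Pt d))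
  cover : volume ((Ω : Set (Pt d)) \ ⋃ T ∈ elements, (T : Set (Pt d))) = 0

/-! ### Smooth functions and weak derivatives -/

/-- The classical partial derivative `∂_i f`. -/
def pd {d : ℕ} (i : Fin d) (f : Pt d → ℝ) : Pt d → ℝ :=
  fun x => fderiv ℝ f x (EuclideanSpace.single i 1)

/-- `ε(∇f) = (D²f + (D²f)ᵀ) / 2`, classically. -/
def epsGrad {d : ℕ} (f : Pt d → ℝ) (x : Pt d) : SymTensor d :=
  ⟨WithLp.toLp 2 (fun p => (1 / 2 : ℝ) * (pd p.1 (pd p.2 f) x + pd p.2 (pd p.1 f) x)), by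
    intro i j
    simp [add_comm]⟩

lemma contDiff_pd {d : ℕ} (i : Fin d) {f : Pt d → ℝ} (hf : ContDiff ℝ ∞ f) :
    ContDiff ℝ ∞ (pd i f) := by
  unfold pd
  exact (hf.fderiv_right (m := ∞) (by simp)).clm_apply contDiff_const

lemma hasCompactSupport_pd {d : ℕ} (i : Fin d) {f : Pt d → ℝ} (hf : HasCompactSupport f) :
    HasCompactSupport (pd i f) :=
  hf.fderiv_apply ℝ _

lemma continuous_epsGrad {d : ℕ} {f : Pt d → ℝ} (hf : ContDiff ℝ ∞ f) :
    Continuous (epsGrad f) := by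
  refine Continuous.subtype_mk ?_ _
  refine (PiLp.continuous_toLp 2 _).comp (continuous_pi fun p => ?_)
  exact continuous_const.mul
    ((contDiff_pd p.1 (contDiff_pd p.2 hf)).continuous.add
      (contDiff_pd p.2 (contDiff_pd p.1 hf)).continuous)

lemma tsupport_pd_subset {d : ℕ} (i : Fin d) (f : Pt d → ℝ) : tsupport (pd i f) ⊆ tsupport f :=
  tsupport_fderiv_apply_subset ℝ _

lemma hasCompactSupport_epsGrad {d : ℕ} {f : Pt d → ℝ} (hf : HasCompactSupport f) :
    HasCompactSupport (epsGrad f) := by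
  refine HasCompactSupport.intro hf fun x hx => ?_
  have h : ∀ i j, pd i (pd j f) x = 0 := fun i j =>
    image_eq_zero_of_notMem_tsupport fun h =>
      hx (tsupport_pd_subset j f (tsupport_pd_subset i _ h))
  refine SymTensor.ext_entry fun i j => ?_
  rw [map_zero]
  change (1 / 2 : ℝ) * (pd i (pd j f) x + pd j (pd i f) x) = 0
  simp [h]

/-- `v` is the weak partial derivative `∂_i u` on the open set `T`. -/
def HasWeakPartial {d : ℕ} (T : Opens (Pt d)) (i : Fin d) (u v : Pt d → ℝ) : Prop :=
  ∀ φ : 𝓓(T, ℝ), ∫ x in (T : Set (Pt d)), u x * pd i φ x = - ∫ x in (T : Set (Pt d)), v x * φ x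

/-- `z ∈ H²(T)` with `ε∇z = H` on `T`, for square integrable `z` and `H`: the weak
gradient `g` of `z` is in `L²(T)` and the weak second derivatives of `z` are the entries of `H`. -/
def HasWeakHessian {d : ℕ} (T : Opens (Pt d)) (z : Pt d → ℝ) (H : Pt d → SymTensor d) : Prop :=
  ∃ g : Fin d → Pt d → ℝ, ∀ i,
    MemLp (g i) 2 (volume.restrict (T : Set (Pt d))) ∧ HasWeakPartial T i z (g i) ∧
    ∀ j, HasWeakPartial T j (g i) (fun x => entry i j (H x))

/-! ### The spaces `L₂(Ω)`, `𝕃₂ˢ(Ω)`, `H²₀(Ω)`, `H²(𝒯)` and `H(div div, Ω)`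

The last three are represented by graphs: an element of `H²₀(Ω)` or `H²(𝒯)` is a pair
`(z, ε∇z)` (piecewise derivatives in the case of `H²(𝒯)`), and an element of `H(div div, Ω)` is a
pair `(Θ, div div Θ)`. The second components are determined by the first ones, and
`(‖·‖² + ‖·‖²)^{1/2}` is the graph norm. -/

/-- `L₂(Ω)`. -/
abbrev L2 {d : ℕ} (Ω : Opens (Pt d)) : Type :=
  Lp ℝ 2 ((volume : Measure (Pt d)).restrict (Ω : Set (Pt d)))

/-- `𝕃₂ˢ(Ω)`, the square integrable symmetric tensor functions. -/
abbrev L2s {d : ℕ} (Ω : Opens (Pt d)) : Type :=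
  Lp (SymTensor d) 2 ((volume : Measure (Pt d)).restrict (Ω : Set (Pt d)))

/-- Pairs `(z, H) ∈ L₂(Ω) × 𝕃₂ˢ(Ω)` with the norm `(‖z‖² + ‖H‖²)^{1/2}`. -/
def HessPair {d : ℕ} (Ω : Opens (Pt d)) : Type := WithLp 2 (L2 Ω × L2s Ω)

instance {d : ℕ} (Ω : Opens (Pt d)) : NormedAddCommGroup (HessPair Ω) :=
  inferInstanceAs (NormedAddCommGroup (WithLp 2 (L2 Ω × L2s Ω)))

instance {d : ℕ} (Ω : Opens (Pt d)) : InnerProductSpace ℝ (HessPair Ω) :=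
  inferInstanceAs (InnerProductSpace ℝ (WithLp 2 (L2 Ω × L2s Ω)))

instance {d : ℕ} (Ω : Opens (Pt d)) : CompleteSpace (HessPair Ω) :=
  inferInstanceAs (CompleteSpace (WithLp 2 (L2 Ω × L2s Ω)))

/-- The function `z` of a pair `(z, H)`. -/
def HessPair.fn {d : ℕ} {Ω : Opens (Pt d)} : HessPair Ω →L[ℝ] L2 Ω :=
  WithLp.fstL 2 ℝ (L2 Ω) (L2s Ω)

/-- The tensor `H` of a pair `(z, H)`. -/
def HessPair.hess {d : ℕ} {Ω : Opens (Pt d)} : HessPair Ω →L[ℝ] L2s Ω :=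
  WithLp.sndL 2 ℝ (L2 Ω) (L2s Ω)

lemma HessPair.norm_sq {d : ℕ} {Ω : Opens (Pt d)} (p : HessPair Ω) :
    ‖p‖ ^ 2 = ‖HessPair.fn p‖ ^ 2 + ‖HessPair.hess p‖ ^ 2 :=
  WithLp.prod_norm_sq_eq_of_L2 p

/-- The pair `(φ, ε∇φ)` of a smooth function `φ` with compact support in `Ω`. -/
def testPair {d : ℕ} {Ω : Opens (Pt d)} (φ : 𝓓(Ω, ℝ)) : HessPair Ω :=
  WithLp.toLp 2
    ((φ.continuous.memLp_of_hasCompactSupport φ.hasCompactSupport).toLp φ,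
     ((continuous_epsGrad φ.contDiff).memLp_of_hasCompactSupport
        (hasCompactSupport_epsGrad φ.hasCompactSupport)).toLp (epsGrad φ))

/-- `H²₀(Ω)`, the closure of `𝒟(Ω)` with respect to `‖z‖₂² = ‖z‖² + ‖ε∇z‖²`. -/
def H20 {d : ℕ} (Ω : Opens (Pt d)) : Submodule ℝ (HessPair Ω) :=
  (Submodule.span ℝ (Set.range (testPair (Ω := Ω)))).topologicalClosure

/-- `H(div div, Ω)`: pairs `(Θ, w)` with `div div Θ = w ∈ L₂(Ω)` in the sense of distributions. -/
def Hdd {d : ℕ} (Ω : Opens (Pt d)) : Submodule ℝ (WithLp 2 (L2s Ω × L2 Ω)) where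
  carrier := {p | ∀ φ : 𝓓(Ω, ℝ),
    inner ℝ p.snd (HessPair.fn (testPair φ)) = inner ℝ p.fst (HessPair.hess (testPair φ))}
  add_mem' := by
    intro a b ha hb φ
    simp [inner_add_left, ha φ, hb φ]
  zero_mem' := by
    intro φ
    simp
  smul_mem' := by
    intro c a ha φ
    simp [real_inner_smul_left, ha φ]

lemma integrable_mul_test {d : ℕ} {T : Opens (Pt d)} {u φ : Pt d → ℝ}
    (hu : MemLp u 2 (volume.restrict (T : Set (Pt d)))) (hφ : Continuous φ)
    (hc : HasCompactSupport φ) :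
    Integrable (fun x => u x * φ x) (volume.restrict (T : Set (Pt d))) :=
  hu.integrable_mul (q := 2) (hφ.memLp_of_hasCompactSupport hc)

lemma HasWeakPartial.add {d : ℕ} {T : Opens (Pt d)} {i : Fin d} {u v u' v' w x : Pt d → ℝ}
    (hu : MemLp u 2 (volume.restrict (T : Set (Pt d))))
    (hv : MemLp v 2 (volume.restrict (T : Set (Pt d))))
    (hu' : MemLp u' 2 (volume.restrict (T : Set (Pt d))))
    (hv' : MemLp v' 2 (volume.restrict (T : Set (Pt d))))
    (h : HasWeakPartial T i u v) (h' : HasWeakPartial T i u' v')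
    (hw : w =ᵐ[volume.restrict (T : Set (Pt d))] fun y => u y + u' y)
    (hx : x =ᵐ[volume.restrict (T : Set (Pt d))] fun y => v y + v' y) :
    HasWeakPartial T i w x := by
  intro φ
  have c1 := (contDiff_pd i φ.contDiff).continuous
  have s1 := hasCompactSupport_pd i φ.hasCompactSupport
  have e1 : ∫ y in (T : Set (Pt d)), w y * pd i φ y
      = ∫ y in (T : Set (Pt d)), (u y * pd i φ y + u' y * pd i φ y) := by
    refine integral_congr_ae ?_
    filter_upwards [hw] with y hy
    rw [hy]; ring
  have e2 : ∫ y in (T : Set (Pt d)), x y * φ y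
      = ∫ y in (T : Set (Pt d)), (v y * φ y + v' y * φ y) := by
    refine integral_congr_ae ?_
    filter_upwards [hx] with y hy
    rw [hy]; ring
  rw [e1, e2, integral_add (integrable_mul_test hu c1 s1) (integrable_mul_test hu' c1 s1),
    integral_add (integrable_mul_test hv φ.continuous φ.hasCompactSupport)
      (integrable_mul_test hv' φ.continuous φ.hasCompactSupport), h φ, h' φ]
  ring

lemma HasWeakPartial.smul {d : ℕ} {T : Opens (Pt d)} {i : Fin d} {u v w x : Pt d → ℝ} (c : ℝ)
    (h : HasWeakPartial T i u v)
    (hw : w =ᵐ[volume.restrict (T : Set (Pt d))] fun y => c * u y)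
    (hx : x =ᵐ[volume.restrict (T : Set (Pt d))] fun y => c * v y) :
    HasWeakPartial T i w x := by
  intro φ
  have e1 : ∫ y in (T : Set (Pt d)), w y * pd i φ y
      = ∫ y in (T : Set (Pt d)), c * (u y * pd i φ y) := by
    refine integral_congr_ae ?_
    filter_upwards [hw] with y hy
    rw [hy]; ring
  have e2 : ∫ y in (T : Set (Pt d)), x y * φ y
      = ∫ y in (T : Set (Pt d)), c * (v y * φ y) := by
    refine integral_congr_ae ?_
    filter_upwards [hx] with y hy
    rw [hy]; ring
  rw [e1, e2, integral_const_mul, integral_const_mul, h φ]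
  ring

lemma ae_mono_of_le {d : ℕ} {T Ω : Opens (Pt d)} (h : T ≤ Ω) {p : Pt d → Prop}
    (hp : ∀ᵐ x ∂(volume.restrict (Ω : Set (Pt d))), p x) :
    ∀ᵐ x ∂(volume.restrict (T : Set (Pt d))), p x :=
  ae_mono (Measure.restrict_mono_set _ h) hp

lemma memLp_entry {d : ℕ} {T Ω : Opens (Pt d)} (h : T ≤ Ω) (H : L2s Ω) (i j : Fin d) :
    MemLp (fun x => entry i j (H x)) 2 (volume.restrict (T : Set (Pt d))) :=
  ((entry i j).comp_memLp' (Lp.memLp H)).mono_measure (Measure.restrict_mono_set _ h)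

/-- `H²(𝒯)`: pairs `(z, ε_𝒯∇_𝒯 z)` with `z ∈ L₂(Ω)`, `z|_T ∈ H²(T)` for all `T ∈ 𝒯`. The norm of
such a pair is the product norm `‖z‖_{2,𝒯}`. -/
def H2Graph {d : ℕ} {Ω : Opens (Pt d)} (𝒯 : Mesh Ω) : Submodule ℝ (HessPair Ω) where
  carrier := {p | ∀ T ∈ 𝒯.elements, HasWeakHessian T (HessPair.fn p) (HessPair.hess p)}
  add_mem' := by
    intro a b ha hb T hT
    obtain ⟨g, hg⟩ := ha T hT
    obtain ⟨g', hg'⟩ := hb T hT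
    have hle := 𝒯.subset T hT
    have m : ∀ f : L2 Ω, MemLp f 2 (volume.restrict (T : Set (Pt d))) := fun f =>
      (Lp.memLp f).mono_measure (Measure.restrict_mono_set _ hle)
    refine ⟨fun i x => g i x + g' i x, fun i => ⟨(hg i).1.add (hg' i).1, ?_, fun j => ?_⟩⟩
    · exact HasWeakPartial.add (m _) (hg i).1 (m _) (hg' i).1 (hg i).2.1 (hg' i).2.1
        (ae_mono_of_le hle (Lp.coeFn_add (HessPair.fn a) (HessPair.fn b))) (by rfl)
    · refine HasWeakPartial.add (hg i).1 (memLp_entry hle _ i j) (hg' i).1 (memLp_entry hle _ i j)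
        ((hg i).2.2 j) ((hg' i).2.2 j) (by rfl) ?_
      filter_upwards [ae_mono_of_le hle (Lp.coeFn_add (HessPair.hess a) (HessPair.hess b))] with x hx
      change entry i j (((HessPair.hess a) + (HessPair.hess b) : L2s Ω) x) = _
      rw [hx, Pi.add_apply, map_add]
  zero_mem' := by
    intro T hT
    have hle := 𝒯.subset T hT
    refine ⟨fun _ _ => 0, fun i => ⟨MemLp.zero, fun φ => ?_, fun j φ => ?_⟩⟩
    · have : ∫ x in (T : Set (Pt d)), (0 : L2 Ω) x * pd i φ x = 0 := by
        refine integral_eq_zero_of_ae ?_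
        filter_upwards [ae_mono_of_le hle (Lp.coeFn_zero ℝ 2 _)] with x hx
        change (0 : L2 Ω) x * pd i φ x = 0
        rw [hx, Pi.zero_apply, zero_mul]
      simpa using this
    · have : ∫ x in (T : Set (Pt d)), entry i j ((0 : L2s Ω) x) * φ x = 0 := by
        refine integral_eq_zero_of_ae ?_
        filter_upwards [ae_mono_of_le hle (Lp.coeFn_zero (SymTensor d) 2 _)] with x hx
        change entry i j ((0 : L2s Ω) x) * φ x = 0
        rw [hx, Pi.zero_apply, map_zero, zero_mul]
      simpa using this
  smul_mem' := by
    intro c a ha T hT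
    obtain ⟨g, hg⟩ := ha T hT
    have hle := 𝒯.subset T hT
    refine ⟨fun i x => c * g i x, fun i => ⟨(hg i).1.const_mul c, ?_, fun j => ?_⟩⟩
    · exact HasWeakPartial.smul c (hg i).2.1 (ae_mono_of_le hle (Lp.coeFn_smul c (HessPair.fn a))) (by rfl)
    · refine HasWeakPartial.smul c ((hg i).2.2 j) (by rfl) ?_
      filter_upwards [ae_mono_of_le hle (Lp.coeFn_smul c (HessPair.hess a))] with x hx
      change entry i j ((c • (HessPair.hess a) : L2s Ω) x) = _
      rw [hx, Pi.smul_apply, map_smul, smul_eq_mul]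

/-- The inner product space `H²(𝒯)` with norm `‖·‖_{2,𝒯}`. -/
def H2 {d : ℕ} {Ω : Opens (Pt d)} (𝒯 : Mesh Ω) : Type := H2Graph 𝒯

instance {d : ℕ} {Ω : Opens (Pt d)} (𝒯 : Mesh Ω) : NormedAddCommGroup (H2 𝒯) :=
  inferInstanceAs (NormedAddCommGroup (H2Graph 𝒯))

instance {d : ℕ} {Ω : Opens (Pt d)} (𝒯 : Mesh Ω) : InnerProductSpace ℝ (H2 𝒯) :=
  inferInstanceAs (InnerProductSpace ℝ (H2Graph 𝒯))

/-- The function `z ∈ L₂(Ω)` underlying an element of `H²(𝒯)`. -/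
def H2.fn {d : ℕ} {Ω : Opens (Pt d)} {𝒯 : Mesh Ω} : H2 𝒯 →L[ℝ] L2 Ω :=
  HessPair.fn.comp (H2Graph 𝒯).subtypeL

/-- The piecewise iterated gradient `ε_𝒯∇_𝒯 z ∈ 𝕃₂ˢ(Ω)` of `z ∈ H²(𝒯)`. -/
def H2.hess {d : ℕ} {Ω : Opens (Pt d)} {𝒯 : Mesh Ω} : H2 𝒯 →L[ℝ] L2s Ω :=
  HessPair.hess.comp (H2Graph 𝒯).subtypeL

lemma H2.norm_sq {d : ℕ} {Ω : Opens (Pt d)} {𝒯 : Mesh Ω} (z : H2 𝒯) :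
    ‖z‖ ^ 2 = ‖H2.fn z‖ ^ 2 + ‖H2.hess z‖ ^ 2 :=
  HessPair.norm_sq z.1

lemma H2.hasWeakHessian {d : ℕ} {Ω : Opens (Pt d)} {𝒯 : Mesh Ω} (z : H2 𝒯)
    {T : Opens (Pt d)} (hT : T ∈ 𝒯.elements) : HasWeakHessian T (H2.fn z) (H2.hess z) :=
  z.2 T hT

/-! ### Traces, jumps, and the projection -/

/-- Restriction to `T`, from `L₂(Ω)` to `L₂(T)`. -/
def restrT {d : ℕ} (F : Type) [NormedAddCommGroup F] [NormedSpace ℝ F] {Ω : Opens (Pt d)}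
    (T : Opens (Pt d)) :
    Lp F 2 ((volume : Measure (Pt d)).restrict (Ω : Set (Pt d))) →L[ℝ]
      Lp F 2 (((volume : Measure (Pt d)).restrict (Ω : Set (Pt d))).restrict (T : Set (Pt d))) :=
  LpToLpRestrictCLM (Pt d) F ℝ _ 2 (T : Set (Pt d))

/-- The local trace `tr_T(Θ)`, acting on `z ∈ H²(𝒯)` through `z|_T`:
`⟨tr_T(Θ), z⟩_{∂T} = (div div Θ, z)_T - (Θ, ε∇z)_T`. -/
def traceT {d : ℕ} {Ω : Opens (Pt d)} (𝒯 : Mesh Ω) (T : Opens (Pt d)) :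
    Hdd Ω →ₗ[ℝ] StrongDual ℝ (H2 𝒯) where
  toFun Θ :=
    (innerSL ℝ (restrT ℝ T Θ.1.snd)).comp ((restrT ℝ T).comp H2.fn) -
      (innerSL ℝ (restrT (SymTensor d) T Θ.1.fst)).comp ((restrT (SymTensor d) T).comp H2.hess)
  map_add' := by
    intro a b
    ext z
    simp
    ring
  map_smul' := by
    intro c a
    ext z
    simp
    ring

/-- The trace in integral form. -/
lemma traceT_apply {d : ℕ} {Ω : Opens (Pt d)} (𝒯 : Mesh Ω) {T : Opens (Pt d)}
    (hT : T ∈ 𝒯.elements) (Θ : Hdd Ω) (z : H2 𝒯) :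
    traceT 𝒯 T Θ z = (∫ x in (T : Set (Pt d)), Θ.1.snd x * (H2.fn z) x)
      - ∫ x in (T : Set (Pt d)), inner ℝ (Θ.1.fst x) ((H2.hess z) x) := by
  have hμ : ((volume : Measure (Pt d)).restrict (Ω : Set (Pt d))).restrict (T : Set (Pt d))
      = volume.restrict (T : Set (Pt d)) := Measure.restrict_restrict_of_subset (𝒯.subset T hT)
  have h1 : inner ℝ (restrT ℝ T Θ.1.snd) (restrT ℝ T (H2.fn z))
      = ∫ x in (T : Set (Pt d)), Θ.1.snd x * (H2.fn z) x := by
    rw [L2.inner_def, ← hμ]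
    refine integral_congr_ae ?_
    filter_upwards [LpToLpRestrictCLM_coeFn ℝ (T : Set (Pt d)) Θ.1.snd,
      LpToLpRestrictCLM_coeFn ℝ (T : Set (Pt d)) (H2.fn z)] with x h h'
    unfold restrT
    rw [h, h', RCLike.inner_apply, conj_trivial, mul_comm]
  have h2 : inner ℝ (restrT (SymTensor d) T Θ.1.fst) (restrT (SymTensor d) T (H2.hess z))
      = ∫ x in (T : Set (Pt d)), inner ℝ (Θ.1.fst x) ((H2.hess z) x) := by
    rw [L2.inner_def, ← hμ]
    refine integral_congr_ae ?_
    filter_upwards [LpToLpRestrictCLM_coeFn ℝ (T : Set (Pt d)) Θ.1.fst,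
      LpToLpRestrictCLM_coeFn ℝ (T : Set (Pt d)) (H2.hess z)] with x h h'
    unfold restrT
    rw [h, h']
  rw [← h1, ← h2]
  rfl

/-- The collective trace operator `H(div div, Ω) → H²(𝒯)'`, `Θ ↦ (tr_T(Θ))_T`, with the duality
`⟨tr(Θ), z⟩_𝒮 = ∑_{T ∈ 𝒯} ⟨tr_T(Θ), z⟩_{∂T}`. -/
def traceDD {d : ℕ} {Ω : Opens (Pt d)} (𝒯 : Mesh Ω) : Hdd Ω →ₗ[ℝ] StrongDual ℝ (H2 𝒯) :=
  ∑ T ∈ 𝒯.elements, traceT 𝒯 T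

lemma traceDD_apply {d : ℕ} {Ω : Opens (Pt d)} (𝒯 : Mesh Ω) (Θ : Hdd Ω) (z : H2 𝒯) :
    traceDD 𝒯 Θ z = ∑ T ∈ 𝒯.elements, traceT 𝒯 T Θ z := by
  simp [traceDD]

/-- The trace space `𝐇^{-3/2,-1/2}(𝒮)`, the range of the collective trace operator. Its norm,
inherited from `H²(𝒯)'`, is `‖q‖_{-3/2,-1/2,𝒮} = sup_{0 ≠ z ∈ H²(𝒯)} ⟨q, z⟩_𝒮 / ‖z‖_{2,𝒯}`. -/
def TraceSpace {d : ℕ} {Ω : Opens (Pt d)} (𝒯 : Mesh Ω) : Type := LinearMap.range (traceDD 𝒯)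

instance {d : ℕ} {Ω : Opens (Pt d)} (𝒯 : Mesh Ω) : NormedAddCommGroup (TraceSpace 𝒯) :=
  Submodule.normedAddCommGroup (LinearMap.range (traceDD 𝒯))

instance {d : ℕ} {Ω : Opens (Pt d)} (𝒯 : Mesh Ω) : NormedSpace ℝ (TraceSpace 𝒯) :=
  Submodule.normedSpace (LinearMap.range (traceDD 𝒯))

/-- The embedding of the trace space into `H²(𝒯)'`; `TraceSpace.toDual q z` is `⟨q, z⟩_𝒮`. -/
def TraceSpace.toDual {d : ℕ} {Ω : Opens (Pt d)} {𝒯 : Mesh Ω} :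
    TraceSpace 𝒯 →ₗᵢ[ℝ] StrongDual ℝ (H2 𝒯) :=
  (LinearMap.range (traceDD 𝒯)).subtypeₗᵢ

/-- The jump functional `⟦z, ∇_𝒯 z⟧ : q ↦ ⟨q, z⟩_𝒮` in `𝐇^{-3/2,-1/2}(𝒮)'`. Its (dual) norm is
`sup_{0 ≠ q ∈ 𝐇^{-3/2,-1/2}(𝒮)} ⟨q, z⟩_𝒮 / ‖q‖_{-3/2,-1/2,𝒮}`. -/
def jump {d : ℕ} {Ω : Opens (Pt d)} (𝒯 : Mesh Ω) (z : H2 𝒯) : StrongDual ℝ (TraceSpace 𝒯) :=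
  (NormedSpace.inclusionInDoubleDual ℝ (H2 𝒯) z).comp TraceSpace.toDual.toContinuousLinearMap

lemma jump_apply {d : ℕ} {Ω : Opens (Pt d)} (𝒯 : Mesh Ω) (z : H2 𝒯) (q : TraceSpace 𝒯) :
    jump 𝒯 z q = TraceSpace.toDual q z := rfl

/-- The subspace `𝒞 ε∇ H²₀(Ω)` of `𝕃₂ˢ(Ω)`, for a constant material tensor `𝒞`. -/
def rangeCEps {d : ℕ} (Ω : Opens (Pt d)) (C : SymTensor d →L[ℝ] SymTensor d) :
    Submodule ℝ (L2s Ω) :=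
  (H20 Ω).map ((C.compLpL 2 (volume.restrict (Ω : Set (Pt d)))).comp
    HessPair.hess).toLinearMap

/-- The projection `P : 𝕃₂ˢ(Ω) → 𝒞 ε∇ H²₀(Ω)` with
`(P(Θ), 𝒞 ε∇ δz) = (Θ, 𝒞 ε∇ δz)` for all `δz ∈ H²₀(Ω)`, i.e. the orthogonal projection.
(For bounded `Ω` and positive definite `𝒞` the subspace is already closed, so that the closure,
which makes the projection well defined in general, does not change it.) -/
def projP {d : ℕ} (Ω : Opens (Pt d)) (C : SymTensor d →L[ℝ] SymTensor d) : L2s Ω →L[ℝ] L2s Ω :=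
  (rangeCEps Ω C).topologicalClosure.starProjection

lemma projP_inner {d : ℕ} (Ω : Opens (Pt d)) (C : SymTensor d →L[ℝ] SymTensor d) (Θ : L2s Ω)
    {s : L2s Ω} (hs : s ∈ rangeCEps Ω C) : inner ℝ (projP Ω C Θ) s = inner ℝ Θ s := by
  have h := (rangeCEps Ω C).topologicalClosure.starProjection_inner_eq_zero Θ s
    (Submodule.le_topologicalClosure _ hs)
  rw [inner_sub_left, sub_eq_zero] at h
  exact h.symm

end PlateDPG

end

/-!
Write `G = ε_𝒯∇_𝒯 z`. Since the skeleton is a null set,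
`⟨tr(Θ), z⟩_𝒮 = (div div Θ, z) - (Θ, G)`, and the trace operator has norm at most one
for every mesh; hence the defect `(div div Θ, z) - (Θ, G)` is bounded by the jump of `z` times the
graph norm of `Θ` (`abs_inner_sub_inner_le_jump`). Two choices of `Θ`, both with norms bounded
independently of the mesh, then suffice.

* `norm_fn_le` bounds `z`. By Lax-Milgram there is `w ∈ H²₀(Ω)` with `div div 𝒞ε∇w = z`
  (`exists_weak_solution`). For `Θ = 𝒞ε∇w` the term `(Θ, G)` is `(Θ, P G)`, so that `‖z‖²` is
  controlled by the jump and `P G`.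
* `norm_hess_le` bounds `G`. The remainder `Q = G - P G` is orthogonal to `𝒞ε∇H²₀(Ω)`, and `𝒞` is
  symmetric, so that `Θ = 𝒞Q` satisfies `div div Θ = 0`. Then `(𝒞Q, G)` is controlled by the jump,
  and `(𝒞Q, Q)` by the jump and `P G`.

The constants come from the positive definiteness of `𝒞` (`stiffness_coercive`) and from the
Poincaré inequality in `H²₀(Ω)` (`norm_fn_le_of_mem_H20`), which for the bounded set `Ω` is the
one-dimensional inequality applied twice in one coordinate direction.
-/

namespace PlateDPG

/-! ### The stiffness tensor -/

lemma abs_entry_le {d : ℕ} (i j : Fin d) (κ : SymTensor d) : |entry i j κ| ≤ ‖κ‖ := by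
  have h := PiLp.norm_apply_le κ.1 (i, j)
  exact h

lemma inner_eq_sum_entry {d : ℕ} (κ κ' : SymTensor d) :
    inner ℝ κ κ' = ∑ i, ∑ j, entry i j κ * entry i j κ' := by
  change inner ℝ κ.1 κ'.1 = _
  rw [PiLp.inner_apply, Fintype.sum_prod_type]
  refine Finset.sum_congr rfl fun i _ => Finset.sum_congr rfl fun j _ => ?_
  rw [RCLike.inner_apply, conj_trivial, mul_comm]
  rfl

lemma inner_idTensor {d : ℕ} (κ : SymTensor d) : inner ℝ (idTensor d) κ = trTensor d κ := by
  have h : ∀ i j, entry i j (idTensor d) = if i = j then 1 else 0 := fun _ _ => rfl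
  simp [inner_eq_sum_entry, h, trTensor]

lemma trTensor_sq_le {d : ℕ} (κ : SymTensor d) : trTensor d κ ^ 2 ≤ d * ‖κ‖ ^ 2 := by
  have h : ‖idTensor d‖ ^ 2 = d := by
    rw [← real_inner_self_eq_norm_sq, inner_idTensor]
    have h : ∀ i, entry i i (idTensor d) = 1 := fun i => if_pos rfl
    simp [trTensor, h]
  rw [← inner_idTensor, ← h, ← mul_pow]
  exact sq_le_sq' (neg_le_of_abs_le (abs_real_inner_le_norm _ _)) (real_inner_le_norm _ _)

lemma inner_stiffness {d : ℕ} (E t ν : ℝ) (κ κ' : SymTensor d) :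
    inner ℝ (stiffness d E t ν κ) κ'
      = rigidity E t ν * (ν * (trTensor d κ * trTensor d κ') + (1 - ν) * inner ℝ κ κ') := by
  simp [stiffness, inner_add_left, real_inner_smul_left, inner_idTensor]
  ring

lemma stiffness_symm {d : ℕ} (E t ν : ℝ) (κ κ' : SymTensor d) :
    inner ℝ (stiffness d E t ν κ) κ' = inner ℝ κ (stiffness d E t ν κ') := by
  rw [real_inner_comm (stiffness d E t ν κ'), inner_stiffness, inner_stiffness,
    real_inner_comm κ, mul_comm (trTensor d κ)]

/-- The stiffness tensor is positive definite: its eigenvalues are `D (1 - ν)` on trace-free tensors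
and `D (1 + (d - 1) ν)` on multiples of the identity. -/
lemma stiffness_coercive {d : ℕ} {E t ν : ℝ} (hE : 0 < E) (ht : 0 < t) (hν₁ : -1 < ν)
    (hν₂ : ν < 1) (hpd : 0 < 1 + ((d : ℝ) - 1) * ν) :
    ∃ α : ℝ, 0 < α ∧ ∀ κ : SymTensor d, α * ‖κ‖ ^ 2 ≤ inner ℝ (stiffness d E t ν κ) κ := by
  have hD : 0 < rigidity E t ν := by
    have : 0 < 1 - ν ^ 2 := by nlinarith
    unfold rigidity
    positivity
  refine ⟨rigidity E t ν * min (1 - ν) (1 + ((d : ℝ) - 1) * ν),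
    mul_pos hD (lt_min (by linarith) hpd), fun κ => ?_⟩
  rw [inner_stiffness, real_inner_self_eq_norm_sq, mul_assoc]
  refine mul_le_mul_of_nonneg_left ?_ hD.le
  rcases le_total 0 ν with h | h
  · have h1 := mul_le_mul_of_nonneg_right (min_le_left (1 - ν) (1 + ((d : ℝ) - 1) * ν))
      (sq_nonneg ‖κ‖)
    nlinarith [mul_nonneg h (mul_self_nonneg (trTensor d κ))]
  · have h1 := mul_le_mul_of_nonneg_right (min_le_right (1 - ν) (1 + ((d : ℝ) - 1) * ν))
      (sq_nonneg ‖κ‖)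
    nlinarith [mul_le_mul_of_nonpos_left (trTensor_sq_le κ) h]

/-- A symmetric map of tensors acts symmetrically on `𝕃₂ˢ(Ω)`. -/
lemma inner_compLpL_symm {d : ℕ} {Ω : Opens (Pt d)} {C : SymTensor d →L[ℝ] SymTensor d}
    (hC : ∀ κ κ', inner ℝ (C κ) κ' = inner ℝ κ (C κ')) (F G : L2s Ω) :
    inner ℝ (C.compLpL 2 (volume.restrict (Ω : Set (Pt d))) F) G
      = inner ℝ F (C.compLpL 2 (volume.restrict (Ω : Set (Pt d))) G) := by
  rw [L2.inner_def, L2.inner_def]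
  refine integral_congr_ae ?_
  filter_upwards [C.coeFn_compLpL (p := 2) F, C.coeFn_compLpL (p := 2) G] with x hF hG
  rw [hF, hG, hC]

/-- A coercive map of tensors is coercive on `𝕃₂ˢ(Ω)` with the same constant. -/
lemma le_inner_compLpL {d : ℕ} {Ω : Opens (Pt d)} {C : SymTensor d →L[ℝ] SymTensor d} {α : ℝ}
    (hC : ∀ κ, α * ‖κ‖ ^ 2 ≤ inner ℝ (C κ) κ) (F : L2s Ω) :
    α * ‖F‖ ^ 2 ≤ inner ℝ (C.compLpL 2 (volume.restrict (Ω : Set (Pt d))) F) F := by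
  rw [← real_inner_self_eq_norm_sq, L2.inner_def, L2.inner_def, ← integral_const_mul]
  refine integral_mono_ae ((L2.integrable_inner F F).const_mul α) (L2.integrable_inner _ _) ?_
  filter_upwards [C.coeFn_compLpL (p := 2) F] with x hF
  rw [hF, real_inner_self_eq_norm_sq]
  exact hC _

/-! ### The Poincaré inequality in `H²₀(Ω)` -/

/-- The one-dimensional Poincaré inequality in direction `i`, from
`∫ u² = -∫ x_i ∂_i(u²) = -2 ∫ x_i u ∂_i u`. -/
lemma integral_sq_le_integral_pd_sq {d : ℕ} (i : Fin d) {u : Pt d → ℝ} (hu : ContDiff ℝ ∞ u)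
    (hc : HasCompactSupport u) {R : ℝ} (hR : ∀ x ∈ tsupport u, |x i| ≤ R) :
    ∫ x, u x ^ 2 ≤ (2 * R) ^ 2 * ∫ x, pd i u x ^ 2 := by
  have hud : Differentiable ℝ u := hu.differentiable (by simp)
  have hpc := (contDiff_pd i hu).continuous
  have hps := hasCompactSupport_pd i hc
  have hx : ∀ x : Pt d, fderiv ℝ (fun y : Pt d => y i) x (EuclideanSpace.single i 1) = 1 := by
    intro x
    have : fderiv ℝ (fun y : Pt d => y i) x = EuclideanSpace.proj i :=
      (EuclideanSpace.proj (𝕜 := ℝ) i).hasFDerivAt.fderiv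
    rw [this]
    simp
  have hsq : ∀ x, fderiv ℝ (fun y => u y ^ 2) x (EuclideanSpace.single i 1)
      = 2 * u x * pd i u x := by
    intro x
    rw [((hud x).hasFDerivAt.pow 2).fderiv]
    simp [pd]
  have hxc : Continuous fun x : Pt d => x i := (EuclideanSpace.proj (𝕜 := ℝ) i).continuous
  have hsqs : HasCompactSupport fun x => u x ^ 2 :=
    HasCompactSupport.intro hc fun x hx => by
      simp [image_eq_zero_of_notMem_tsupport hx]
  have i1 : Integrable fun x => u x ^ 2 :=
    (hu.continuous.memLp_of_hasCompactSupport hc).integrable_sq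
  have i2 : Integrable fun x => pd i u x ^ 2 :=
    (hpc.memLp_of_hasCompactSupport hps).integrable_sq
  have i3 : Integrable fun x : Pt d => x i * (2 * u x * pd i u x) :=
    (hxc.mul ((continuous_const.mul hu.continuous).mul hpc)).integrable_of_hasCompactSupport
      (HasCompactSupport.mul_left (f := fun x : Pt d => x i)
        (HasCompactSupport.mul_left (f := fun x => 2 * u x) hps))
  have i4 : Integrable fun x : Pt d => x i * u x ^ 2 :=
    (hxc.mul (hu.continuous.pow 2)).integrable_of_hasCompactSupport
      (HasCompactSupport.mul_left (f := fun x : Pt d => x i) hsqs)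
  have key := integral_mul_fderiv_eq_neg_fderiv_mul_of_integrable (μ := volume)
    (f := fun x : Pt d => x i) (g := fun x => u x ^ 2) (v := EuclideanSpace.single i 1)
    (by simpa only [hx, one_mul] using i1) (by simpa only [hsq] using i3) i4
    (fun x _ => (EuclideanSpace.proj (𝕜 := ℝ) i).differentiableAt)
    (fun x _ => (hud x).pow 2)
  simp only [hx, hsq, one_mul] at key
  have hle : -∫ x : Pt d, x i * (2 * u x * pd i u x)
      ≤ ∫ x, ((1 / 2) * u x ^ 2 + 2 * R ^ 2 * pd i u x ^ 2) := by
    -- Young's inequality, weighted so that half of `∫ u²` can be absorbed.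
    rw [← integral_neg]
    refine integral_mono i3.neg ((i1.const_mul _).add (i2.const_mul _)) fun x => ?_
    by_cases h : x ∈ tsupport u
    · have h1 : x i ^ 2 ≤ R ^ 2 := sq_le_sq' (neg_le_of_abs_le (hR x h)) (le_of_abs_le (hR x h))
      have h2 := mul_le_mul_of_nonneg_right h1 (sq_nonneg (pd i u x))
      simp only
      nlinarith [sq_nonneg (u x + 2 * (x i * pd i u x))]
    · have h1 : u x = 0 := image_eq_zero_of_notMem_tsupport h
      simp only [h1]
      have : 0 ≤ R ^ 2 * pd i u x ^ 2 := by positivity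
      simp
      linarith
  rw [integral_add (i1.const_mul _) (i2.const_mul _), integral_const_mul, integral_const_mul] at hle
  linarith

lemma coeFn_fn_testPair {d : ℕ} {Ω : Opens (Pt d)} (φ : 𝓓(Ω, ℝ)) :
    HessPair.fn (testPair φ) =ᵐ[volume.restrict (Ω : Set (Pt d))] φ :=
  (φ.continuous.memLp_of_hasCompactSupport φ.hasCompactSupport).coeFn_toLp

lemma coeFn_hess_testPair {d : ℕ} {Ω : Opens (Pt d)} (φ : 𝓓(Ω, ℝ)) :
    HessPair.hess (testPair φ) =ᵐ[volume.restrict (Ω : Set (Pt d))] epsGrad φ :=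
  ((continuous_epsGrad φ.contDiff).memLp_of_hasCompactSupport
    (hasCompactSupport_epsGrad φ.hasCompactSupport)).coeFn_toLp

lemma norm_sq_fn_testPair {d : ℕ} {Ω : Opens (Pt d)} (φ : 𝓓(Ω, ℝ)) :
    ‖HessPair.fn (testPair φ)‖ ^ 2 = ∫ x, φ x ^ 2 := by
  rw [← real_inner_self_eq_norm_sq, L2.inner_def]
  have h : ∫ x in (Ω : Set (Pt d)), φ x ^ 2 = ∫ x, φ x ^ 2 :=
    setIntegral_eq_integral_of_forall_compl_eq_zero fun x hx => by
      rw [image_eq_zero_of_notMem_tsupport fun h => hx (φ.tsupport_subset h)]; simp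
  rw [← h]
  refine integral_congr_ae ?_
  filter_upwards [coeFn_fn_testPair φ] with x hx
  rw [hx, real_inner_self_eq_norm_sq, Real.norm_eq_abs, sq_abs]

lemma integral_sq_pd_pd_le {d : ℕ} {Ω : Opens (Pt d)} (i : Fin d) (φ : 𝓓(Ω, ℝ)) :
    ∫ x, pd i (pd i φ) x ^ 2 ≤ ‖HessPair.hess (testPair φ)‖ ^ 2 := by
  rw [← real_inner_self_eq_norm_sq, L2.inner_def]
  have h : ∫ x in (Ω : Set (Pt d)), pd i (pd i φ) x ^ 2 = ∫ x, pd i (pd i φ) x ^ 2 :=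
    setIntegral_eq_integral_of_forall_compl_eq_zero fun x hx => by
      rw [image_eq_zero_of_notMem_tsupport fun h => hx (φ.tsupport_subset
        (tsupport_pd_subset i φ (tsupport_pd_subset i _ h)))]; simp
  rw [← h]
  have c2 := (contDiff_pd i (contDiff_pd i φ.contDiff)).continuous
  have s2 := hasCompactSupport_pd i (hasCompactSupport_pd i φ.hasCompactSupport)
  refine integral_mono_ae (c2.memLp_of_hasCompactSupport s2).integrable_sq
    (L2.integrable_inner _ _) ?_
  filter_upwards [coeFn_hess_testPair φ] with x hx
  rw [hx, real_inner_self_eq_norm_sq]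
  have he : entry i i (epsGrad φ x) = pd i (pd i φ) x := by
    change (1 / 2 : ℝ) * (pd i (pd i φ) x + pd i (pd i φ) x) = _
    ring
  rw [← he]
  exact sq_le_sq' (neg_le_of_abs_le (abs_entry_le i i _)) (le_of_abs_le (abs_entry_le i i _))

lemma norm_fn_testPair_le {d : ℕ} {Ω : Opens (Pt d)} (i : Fin d) {R : ℝ}
    (hR : ∀ x ∈ Ω, |x i| ≤ R) (φ : 𝓓(Ω, ℝ)) :
    ‖HessPair.fn (testPair φ)‖ ≤ (2 * R) ^ 2 * ‖HessPair.hess (testPair φ)‖ := by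
  refine le_of_sq_le_sq ?_ (by positivity)
  have h1 := integral_sq_le_integral_pd_sq i φ.contDiff φ.hasCompactSupport
    fun x hx => hR x (φ.tsupport_subset hx)
  have h2 := integral_sq_le_integral_pd_sq i (contDiff_pd i φ.contDiff)
    (hasCompactSupport_pd i φ.hasCompactSupport)
    fun x hx => hR x (φ.tsupport_subset (tsupport_pd_subset i φ hx))
  have hp : 0 ≤ (2 * R) ^ 2 := by positivity
  calc ‖HessPair.fn (testPair φ)‖ ^ 2 = ∫ x, φ x ^ 2 := norm_sq_fn_testPair φ
    _ ≤ (2 * R) ^ 2 * ∫ x, pd i φ x ^ 2 := h1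
    _ ≤ (2 * R) ^ 2 * ((2 * R) ^ 2 * ‖HessPair.hess (testPair φ)‖ ^ 2) := by
      refine mul_le_mul_of_nonneg_left (h2.trans ?_) hp
      exact mul_le_mul_of_nonneg_left (integral_sq_pd_pd_le i φ) hp
    _ = _ := by ring

lemma pd_add {d : ℕ} (i : Fin d) {f g : Pt d → ℝ} (hf : ContDiff ℝ ∞ f) (hg : ContDiff ℝ ∞ g) :
    pd i (f + g) = pd i f + pd i g := by
  ext x
  simp [pd, fderiv_add (hf.differentiable (by simp) x) (hg.differentiable (by simp) x)]

lemma pd_smul {d : ℕ} (i : Fin d) (c : ℝ) {f : Pt d → ℝ} (hf : ContDiff ℝ ∞ f) :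
    pd i (c • f) = c • pd i f := by
  ext x
  simp [pd, fderiv_const_smul (hf.differentiable (by simp) x)]

lemma epsGrad_add {d : ℕ} {f g : Pt d → ℝ} (hf : ContDiff ℝ ∞ f) (hg : ContDiff ℝ ∞ g) :
    epsGrad (f + g) = epsGrad f + epsGrad g := by
  funext x
  refine SymTensor.ext_entry fun i j => ?_
  rw [Pi.add_apply, map_add]
  change (1 / 2 : ℝ) * (pd i (pd j (f + g)) x + pd j (pd i (f + g)) x)
    = (1 / 2 : ℝ) * (pd i (pd j f) x + pd j (pd i f) x)
      + (1 / 2 : ℝ) * (pd i (pd j g) x + pd j (pd i g) x)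
  rw [pd_add j hf hg, pd_add i hf hg, pd_add i (contDiff_pd j hf) (contDiff_pd j hg),
    pd_add j (contDiff_pd i hf) (contDiff_pd i hg), Pi.add_apply, Pi.add_apply]
  ring

lemma epsGrad_smul {d : ℕ} (c : ℝ) {f : Pt d → ℝ} (hf : ContDiff ℝ ∞ f) :
    epsGrad (c • f) = c • epsGrad f := by
  funext x
  refine SymTensor.ext_entry fun i j => ?_
  rw [Pi.smul_apply, map_smul]
  change (1 / 2 : ℝ) * (pd i (pd j (c • f)) x + pd j (pd i (c • f)) x)
    = c * ((1 / 2 : ℝ) * (pd i (pd j f) x + pd j (pd i f) x))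
  rw [pd_smul j c hf, pd_smul i c hf, pd_smul i c (contDiff_pd j hf),
    pd_smul j c (contDiff_pd i hf), Pi.smul_apply, Pi.smul_apply, smul_eq_mul, smul_eq_mul]
  ring

lemma testPair_add {d : ℕ} {Ω : Opens (Pt d)} (φ ψ : 𝓓(Ω, ℝ)) :
    testPair (φ + ψ) = testPair φ + testPair ψ := by
  refine (WithLp.ofLp_injective 2) (Prod.ext rfl (Lp.ext ?_))
  change HessPair.hess (testPair (φ + ψ)) =ᵐ[_]
    (HessPair.hess (testPair φ) + HessPair.hess (testPair ψ) : L2s Ω)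
  have he : epsGrad ⇑(φ + ψ) = epsGrad φ + epsGrad ψ := epsGrad_add φ.contDiff ψ.contDiff
  refine (coeFn_hess_testPair _).trans (.trans ?_ (Lp.coeFn_add _ _).symm)
  rw [he]
  exact ((coeFn_hess_testPair φ).add (coeFn_hess_testPair ψ)).symm

lemma testPair_smul {d : ℕ} {Ω : Opens (Pt d)} (c : ℝ) (φ : 𝓓(Ω, ℝ)) :
    testPair (c • φ) = c • testPair φ := by
  refine (WithLp.ofLp_injective 2) (Prod.ext rfl (Lp.ext ?_))
  change HessPair.hess (testPair (c • φ)) =ᵐ[_] (c • HessPair.hess (testPair φ) : L2s Ω)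
  have he : epsGrad ⇑(c • φ) = c • epsGrad φ := epsGrad_smul c φ.contDiff
  refine (coeFn_hess_testPair _).trans (.trans ?_ (Lp.coeFn_smul _ _).symm)
  rw [he]
  exact ((coeFn_hess_testPair φ).const_smul c).symm

/-- The test pairs already form a subspace, so that `H²₀(Ω)` is the closure of their set. -/
lemma span_range_testPair {d : ℕ} (Ω : Opens (Pt d)) :
    (Submodule.span ℝ (Set.range (testPair (Ω := Ω))) : Set (HessPair Ω))
      = Set.range testPair := by
  let f : 𝓓(Ω, ℝ) →ₗ[ℝ] HessPair Ω :=
    { toFun := testPair, map_add' := testPair_add, map_smul' := testPair_smul }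
  exact congrArg SetLike.coe (Submodule.span_eq (LinearMap.range f))

lemma testPair_mem_H20 {d : ℕ} {Ω : Opens (Pt d)} (φ : 𝓓(Ω, ℝ)) : testPair φ ∈ H20 Ω :=
  Submodule.le_topologicalClosure _ (Submodule.subset_span ⟨φ, rfl⟩)

/-- Poincaré inequality in `H²₀(Ω)`, for `Ω` bounded in direction `i`. -/
lemma norm_fn_le_of_mem_H20 {d : ℕ} {Ω : Opens (Pt d)} (i : Fin d) {R : ℝ}
    (hR : ∀ x ∈ Ω, |x i| ≤ R) {p : HessPair Ω} (hp : p ∈ H20 Ω) :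
    ‖HessPair.fn p‖ ≤ (2 * R) ^ 2 * ‖HessPair.hess p‖ := by
  have hcl : IsClosed {p : HessPair Ω | ‖HessPair.fn p‖ ≤ (2 * R) ^ 2 * ‖HessPair.hess p‖} :=
    isClosed_le HessPair.fn.continuous.norm (continuous_const.mul HessPair.hess.continuous.norm)
  refine closure_minimal ((span_range_testPair Ω).subset.trans ?_) hcl hp
  rintro _ ⟨φ, rfl⟩
  exact norm_fn_testPair_le i hR φ

/-! ### Traces and jumps -/

/-- Summing over the elements of a mesh gives integrals over `Ω`, as the skeleton is a null set. -/
lemma Mesh.sum_setIntegral {d : ℕ} {Ω : Opens (Pt d)} (𝒯 : Mesh Ω) {f : Pt d → ℝ}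
    (hf : IntegrableOn f Ω) :
    ∑ T ∈ 𝒯.elements, ∫ x in (T : Set (Pt d)), f x = ∫ x in (Ω : Set (Pt d)), f x := by
  have hsub : (⋃ T ∈ 𝒯.elements, (T : Set (Pt d))) ⊆ Ω :=
    Set.iUnion₂_subset fun T hT => 𝒯.subset T hT
  rw [← integral_biUnion_finset 𝒯.elements (fun T _ => T.isOpen.measurableSet)
    (fun T hT T' hT' h => 𝒯.disjoint T hT T' hT' h) fun T hT => hf.mono_set (𝒯.subset T hT)]
  refine setIntegral_congr_set ?_
  exact hsub.eventuallyLE.antisymm (ae_le_set.2 𝒯.cover)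

/-- `⟨tr(Θ), z⟩_𝒮 = (div div Θ, z) - (Θ, ε_𝒯∇_𝒯 z)`. -/
lemma traceDD_eq_inner {d : ℕ} {Ω : Opens (Pt d)} (𝒯 : Mesh Ω) (Θ : Hdd Ω) (z : H2 𝒯) :
    traceDD 𝒯 Θ z = inner ℝ Θ.1.snd (H2.fn z) - inner ℝ Θ.1.fst (H2.hess z) := by
  have h1 : inner ℝ Θ.1.snd (H2.fn z)
      = ∑ T ∈ 𝒯.elements, ∫ x in (T : Set (Pt d)), Θ.1.snd x * (H2.fn z) x := by
    have h : ∀ x, inner ℝ (Θ.1.snd x) ((H2.fn z) x) = Θ.1.snd x * (H2.fn z) x := fun x => by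
      rw [RCLike.inner_apply, conj_trivial, mul_comm]
    have hi := L2.integrable_inner (𝕜 := ℝ) Θ.1.snd (H2.fn z)
    rw [L2.inner_def]
    simp only [h] at hi ⊢
    exact (𝒯.sum_setIntegral hi).symm
  have h2 : inner ℝ Θ.1.fst (H2.hess z)
      = ∑ T ∈ 𝒯.elements, ∫ x in (T : Set (Pt d)), inner ℝ (Θ.1.fst x) ((H2.hess z) x) := by
    rw [L2.inner_def]
    exact (𝒯.sum_setIntegral (L2.integrable_inner (𝕜 := ℝ) Θ.1.fst (H2.hess z))).symm
  rw [traceDD_apply, h1, h2, ← Finset.sum_sub_distrib]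
  exact Finset.sum_congr rfl fun T hT => traceT_apply 𝒯 hT Θ z

/-- The trace operator has norm at most one, whatever the mesh. -/
lemma norm_traceDD_le {d : ℕ} {Ω : Opens (Pt d)} (𝒯 : Mesh Ω) (Θ : Hdd Ω) :
    ‖traceDD 𝒯 Θ‖ ≤ ‖Θ‖ := by
  refine ContinuousLinearMap.opNorm_le_bound _ (norm_nonneg _) fun z => ?_
  have hΘ : ‖Θ‖ ^ 2 = ‖Θ.1.fst‖ ^ 2 + ‖Θ.1.snd‖ ^ 2 := WithLp.prod_norm_sq_eq_of_L2 Θ.1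
  have hz := H2.norm_sq z
  have h1 := abs_real_inner_le_norm Θ.1.snd (H2.fn z)
  have h2 := abs_real_inner_le_norm Θ.1.fst (H2.hess z)
  have h3 : (‖Θ.1.snd‖ * ‖H2.fn z‖ + ‖Θ.1.fst‖ * ‖H2.hess z‖) ^ 2 ≤ (‖Θ‖ * ‖z‖) ^ 2 := by
    rw [mul_pow, hΘ, hz]
    nlinarith [sq_nonneg (‖Θ.1.snd‖ * ‖H2.hess z‖ - ‖Θ.1.fst‖ * ‖H2.fn z‖)]
  rw [traceDD_eq_inner, Real.norm_eq_abs]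
  calc _ ≤ _ := abs_sub _ _
    _ ≤ _ := add_le_add h1 h2
    _ ≤ _ := le_of_sq_le_sq h3 (by positivity)

/-- The defect `(div div Θ, z) - (Θ, ε_𝒯∇_𝒯 z)` in Green's identity is bounded by the jump of `z`
and the graph norm of `Θ`. -/
lemma abs_inner_sub_inner_le_jump {d : ℕ} {Ω : Opens (Pt d)} (𝒯 : Mesh Ω) (Θ : Hdd Ω) (z : H2 𝒯) :
    |inner ℝ Θ.1.snd (H2.fn z) - inner ℝ Θ.1.fst (H2.hess z)| ≤ ‖jump 𝒯 z‖ * ‖Θ‖ := by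
  let q : TraceSpace 𝒯 := ⟨traceDD 𝒯 Θ, Θ, rfl⟩
  have h := (jump 𝒯 z).le_opNorm q
  rw [← traceDD_eq_inner]
  exact h.trans (mul_le_mul_of_nonneg_left (norm_traceDD_le 𝒯 Θ) (norm_nonneg _))

lemma norm_Hdd_le {d : ℕ} {Ω : Opens (Pt d)} (Θ : Hdd Ω) :
    ‖Θ‖ ≤ ‖Θ.1.fst‖ + ‖Θ.1.snd‖ := by
  have hΘ : ‖Θ‖ ^ 2 = ‖Θ.1.fst‖ ^ 2 + ‖Θ.1.snd‖ ^ 2 := WithLp.prod_norm_sq_eq_of_L2 Θ.1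
  refine le_of_sq_le_sq ?_ (by positivity)
  nlinarith [mul_nonneg (norm_nonneg Θ.1.fst) (norm_nonneg Θ.1.snd)]

/-! ### The estimate -/

/-- The plate problem `div div 𝒞ε∇w = f` with `w ∈ H²₀(Ω)` is solvable in weak form with the
Lax-Milgram bound of `ε∇w`; `κ` is a Poincaré constant of `H²₀(Ω)`. -/
lemma exists_weak_solution {d : ℕ} {Ω : Opens (Pt d)} {C : SymTensor d →L[ℝ] SymTensor d}
    {α κ : ℝ} (hα : 0 < α) (hC : ∀ κ, α * ‖κ‖ ^ 2 ≤ inner ℝ (C κ) κ) (hκ₀ : 0 ≤ κ)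
    (hκ : ∀ p ∈ H20 Ω, ‖HessPair.fn p‖ ≤ κ * ‖HessPair.hess p‖) (f : L2 Ω) :
    ∃ w ∈ H20 Ω, α * ‖HessPair.hess w‖ ≤ κ * ‖f‖ ∧ ∀ p ∈ H20 Ω,
      inner ℝ (C.compLpL 2 (volume.restrict (Ω : Set (Pt d))) (HessPair.hess w)) (HessPair.hess p)
        = inner ℝ f (HessPair.fn p) := by
  let A : H20 Ω →L[ℝ] L2s Ω := HessPair.hess.comp (H20 Ω).subtypeL
  let B : H20 Ω →L[ℝ] H20 Ω →L[ℝ] ℝ :=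
    (innerSL ℝ).bilinearComp ((C.compLpL 2 (volume.restrict (Ω : Set (Pt d)))).comp A) A
  have hB : ∀ u v : H20 Ω, B u v = inner ℝ (C.compLpL 2 (volume.restrict (Ω : Set (Pt d)))
    (HessPair.hess u.1)) (HessPair.hess v.1) := fun _ _ => rfl
  have : CompleteSpace (H20 Ω) := (Submodule.isClosed_topologicalClosure _).completeSpace_coe
  have hco : IsCoercive B := by
    refine ⟨α / (1 + κ ^ 2), by positivity, fun u => ?_⟩
    have h1 := le_inner_compLpL hC (HessPair.hess u.1)
    have h2 : ‖u‖ ^ 2 = ‖HessPair.fn u.1‖ ^ 2 + ‖HessPair.hess u.1‖ ^ 2 := HessPair.norm_sq u.1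
    have h3 := pow_le_pow_left₀ (norm_nonneg _) (hκ u.1 u.2) 2
    rw [hB]
    refine le_trans ?_ h1
    rw [mul_assoc, ← pow_two, h2, div_mul_eq_mul_div, div_le_iff₀ (by positivity), mul_assoc]
    refine mul_le_mul_of_nonneg_left ?_ hα.le
    nlinarith
  let F : StrongDual ℝ (H20 Ω) := (innerSL ℝ f).comp (HessPair.fn.comp (H20 Ω).subtypeL)
  let w : H20 Ω := hco.continuousLinearEquivOfBilin.symm ((InnerProductSpace.toDual ℝ _).symm F)
  have hw : ∀ p : H20 Ω, B w p = inner ℝ f (HessPair.fn p.1) := by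
    intro p
    rw [← hco.continuousLinearEquivOfBilin_apply]
    simp only [w, ContinuousLinearEquiv.apply_symm_apply]
    rw [InnerProductSpace.toDual_symm_apply]
    rfl
  refine ⟨w.1, w.2, ?_, fun p hp => hw ⟨p, hp⟩⟩
  have h1 := le_inner_compLpL hC (HessPair.hess w.1)
  rw [← hB, hw w] at h1
  have h2 := (h1.trans (real_inner_le_norm _ _)).trans
    (mul_le_mul_of_nonneg_left (hκ w.1 w.2) (norm_nonneg _))
  rcases (norm_nonneg (HessPair.hess w.1)).eq_or_lt with h | h
  · rw [← h, mul_zero]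
    positivity
  · exact le_of_mul_le_mul_right (by nlinarith) h

/-- The bound of `‖z‖`: Green's identity is tested with `Θ = 𝒞ε∇w`, where `w ∈ H²₀(Ω)` solves
`div div 𝒞ε∇w = z`. -/
lemma norm_fn_le {d : ℕ} {Ω : Opens (Pt d)} {C : SymTensor d →L[ℝ] SymTensor d} {α κ : ℝ}
    (hα : 0 < α) (hC : ∀ κ, α * ‖κ‖ ^ 2 ≤ inner ℝ (C κ) κ) (hκ₀ : 0 ≤ κ)
    (hκ : ∀ p ∈ H20 Ω, ‖HessPair.fn p‖ ≤ κ * ‖HessPair.hess p‖) (𝒯 : Mesh Ω) (z : H2 𝒯) :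
    ‖H2.fn z‖ ≤ (‖C‖ * κ / α + 1) * (‖projP Ω C (H2.hess z)‖ + ‖jump 𝒯 z‖) := by
  obtain ⟨w, hw, hwn, hweq⟩ := exists_weak_solution hα hC hκ₀ hκ (H2.fn z)
  set s : L2s Ω := C.compLpL 2 (volume.restrict (Ω : Set (Pt d))) (HessPair.hess w) with hs
  let Θ : Hdd Ω := ⟨WithLp.toLp 2 (s, H2.fn z), fun φ => (hweq _ (testPair_mem_H20 φ)).symm⟩
  have hsn : ‖s‖ ≤ ‖C‖ * κ / α * ‖H2.fn z‖ := by
    have h1 : ‖s‖ ≤ ‖C‖ * ‖HessPair.hess w‖ :=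
      (ContinuousLinearMap.le_opNorm _ _).trans
        (mul_le_mul_of_nonneg_right C.norm_compLpL_le (norm_nonneg _))
    have h2 : ‖HessPair.hess w‖ ≤ κ * ‖H2.fn z‖ / α := by rwa [le_div_iff₀' hα]
    calc _ ≤ _ := h1
      _ ≤ _ := mul_le_mul_of_nonneg_left h2 (norm_nonneg _)
      _ = _ := by ring
  have h1 : |inner ℝ (H2.fn z) (H2.fn z) - inner ℝ s (H2.hess z)| ≤ ‖jump 𝒯 z‖ * ‖Θ‖ :=
    abs_inner_sub_inner_le_jump 𝒯 Θ z
  have h2 : ‖Θ‖ ≤ ‖s‖ + ‖H2.fn z‖ := norm_Hdd_le Θ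
  have h3 : inner ℝ s (H2.hess z) ≤ ‖projP Ω C (H2.hess z)‖ * ‖s‖ := by
    have h : inner ℝ (projP Ω C (H2.hess z)) s = inner ℝ (H2.hess z) s :=
      projP_inner Ω C (H2.hess z) ⟨w, hw, rfl⟩
    rw [real_inner_comm, ← h]
    exact real_inner_le_norm _ _
  rw [real_inner_self_eq_norm_sq] at h1
  set J := ‖jump 𝒯 z‖
  set P := ‖projP Ω C (H2.hess z)‖
  set K := ‖C‖ * κ / α
  have hJ : 0 ≤ J := norm_nonneg _
  have hP : 0 ≤ P := norm_nonneg _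
  have h4 : ‖H2.fn z‖ * ‖H2.fn z‖ ≤ (K + 1) * (P + J) * ‖H2.fn z‖ :=
    calc ‖H2.fn z‖ * ‖H2.fn z‖ ≤ J * ‖Θ‖ + P * ‖s‖ := by
          linarith [le_of_abs_le h1]
      _ ≤ J * (K * ‖H2.fn z‖ + ‖H2.fn z‖) + P * (K * ‖H2.fn z‖) := by
          gcongr
          linarith
      _ ≤ _ := by nlinarith [mul_nonneg hP (norm_nonneg (H2.fn z))]
  rcases (norm_nonneg (H2.fn z)).eq_or_lt with h | h
  · rw [← h]
    positivity
  · exact le_of_mul_le_mul_right h4 h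

/-- The bound of `ε_𝒯∇_𝒯 z`: its component `Q` orthogonal to `𝒞ε∇H²₀(Ω)` satisfies
`div div 𝒞Q = 0`, and Green's identity is tested with `Θ = 𝒞Q`. -/
lemma norm_hess_le {d : ℕ} {Ω : Opens (Pt d)} {C : SymTensor d →L[ℝ] SymTensor d} {α : ℝ}
    (hα : 0 < α) (hsymm : ∀ κ κ', inner ℝ (C κ) κ' = inner ℝ κ (C κ'))
    (hC : ∀ κ, α * ‖κ‖ ^ 2 ≤ inner ℝ (C κ) κ) (𝒯 : Mesh Ω) (z : H2 𝒯) :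
    ‖H2.hess z‖ ≤ (‖C‖ / α + 1) * (‖projP Ω C (H2.hess z)‖ + ‖jump 𝒯 z‖) := by
  set G := H2.hess z with hG
  set Q : L2s Ω := G - projP Ω C G with hQ
  set s : L2s Ω := C.compLpL 2 (volume.restrict (Ω : Set (Pt d))) Q with hs
  have hmem : WithLp.toLp 2 (s, (0 : L2 Ω)) ∈ Hdd Ω := by
    intro φ
    change inner ℝ (0 : L2 Ω) _ = inner ℝ s _
    rw [inner_zero_left, hs, inner_compLpL_symm hsymm, hQ, inner_sub_left]
    exact (sub_eq_zero.2 (projP_inner Ω C G ⟨_, testPair_mem_H20 φ, rfl⟩).symm).symm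
  let Θ : Hdd Ω := ⟨_, hmem⟩
  have hsn : ‖s‖ ≤ ‖C‖ * ‖Q‖ :=
    (ContinuousLinearMap.le_opNorm _ _).trans
      (mul_le_mul_of_nonneg_right C.norm_compLpL_le (norm_nonneg _))
  have h1 : |inner ℝ (0 : L2 Ω) (H2.fn z) - inner ℝ s G| ≤ ‖jump 𝒯 z‖ * ‖Θ‖ :=
    abs_inner_sub_inner_le_jump 𝒯 Θ z
  have h2 : ‖Θ‖ ≤ ‖s‖ + ‖(0 : L2 Ω)‖ := norm_Hdd_le Θ
  rw [norm_zero, add_zero] at h2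
  rw [inner_zero_left, zero_sub, abs_neg] at h1
  have h3 : α * ‖Q‖ ^ 2 ≤ inner ℝ s G - inner ℝ s (projP Ω C G) := by
    rw [← inner_sub_right]
    exact le_inner_compLpL hC Q
  have h4 : -inner ℝ s (projP Ω C G) ≤ ‖s‖ * ‖projP Ω C G‖ :=
    (neg_le_abs _).trans (abs_real_inner_le_norm _ _)
  have h5 : ‖G‖ ≤ ‖Q‖ + ‖projP Ω C G‖ := by
    simpa [hQ] using norm_add_le Q (projP Ω C G)
  set J := ‖jump 𝒯 z‖
  set P := ‖projP Ω C G‖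
  have hJ : 0 ≤ J := norm_nonneg _
  have hP : 0 ≤ P := norm_nonneg _
  have h6 : ‖Q‖ ≤ ‖C‖ / α * (P + J) := by
    have h7 : α * ‖Q‖ * ‖Q‖ ≤ ‖C‖ * (P + J) * ‖Q‖ :=
      calc α * ‖Q‖ * ‖Q‖ ≤ J * ‖Θ‖ + ‖s‖ * P := by
            linarith [le_of_abs_le h1]
        _ ≤ J * (‖C‖ * ‖Q‖) + ‖C‖ * ‖Q‖ * P := by
            gcongr
            exact h2.trans hsn
        _ = _ := by ring
    rcases (norm_nonneg Q).eq_or_lt with h | h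
    · rw [← h]
      positivity
    · rw [div_mul_eq_mul_div, le_div_iff₀' hα]
      exact le_of_mul_le_mul_right h7 h
  linarith

end PlateDPG

/-- Poincaré inequality in the product space `H²(𝒯)`. For `z : H2 𝒯`, `H2.fn z` is the underlying
function, `H2.hess z` is `ε_𝒯∇_𝒯 z`, and `‖z‖` is `‖z‖_{2,𝒯}`. -/
theorem mainTheorem4 (d : ℕ) (hd : d = 2 ∨ d = 3)
    (Ω : TopologicalSpace.Opens (PlateDPG.Pt d)) (hΩ : PlateDPG.IsBoundedLipschitz Ω)
    (hΩsc : SimplyConnectedSpace Ω)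
    (E t ν : ℝ) (hE : 0 < E) (ht : 0 < t) (hν₁ : -1 < ν) (hν₂ : ν ≤ 1 / 2)
    (hpd : 0 < 1 + ((d : ℝ) - 1) * ν) :
    ∃ c : ℝ, 0 < c ∧ ∀ (𝒯 : PlateDPG.Mesh Ω) (z : PlateDPG.H2 𝒯),
      ‖z‖ ≤ c * (‖PlateDPG.projP Ω (PlateDPG.stiffness d E t ν) (PlateDPG.H2.hess z)‖
        + ‖PlateDPG.jump 𝒯 z‖) := by
  obtain ⟨α, hα, hC⟩ :=
    PlateDPG.stiffness_coercive hE ht hν₁ (hν₂.trans_lt (by norm_num)) hpd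
  obtain ⟨R, hR⟩ := hΩ.1.exists_norm_le
  let i : Fin d := ⟨0, by omega⟩
  have hκ := fun p => PlateDPG.norm_fn_le_of_mem_H20 (p := p) i
    fun x hx => (PiLp.norm_apply_le x i).trans (hR x hx)
  set C := PlateDPG.stiffness d E t ν
  refine ⟨(‖C‖ * (2 * R) ^ 2 / α + 1) + (‖C‖ / α + 1), by positivity, fun 𝒯 z => ?_⟩
  have h1 := PlateDPG.norm_fn_le hα hC (by positivity) hκ 𝒯 z
  have h2 := PlateDPG.norm_hess_le hα (PlateDPG.stiffness_symm E t ν) hC 𝒯 z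
  have h3 : ‖z‖ ≤ ‖PlateDPG.H2.fn z‖ + ‖PlateDPG.H2.hess z‖ := by
    refine le_of_sq_le_sq ?_ (by positivity)
    rw [PlateDPG.H2.norm_sq]
    nlinarith [mul_nonneg (norm_nonneg (PlateDPG.H2.fn z)) (norm_nonneg (PlateDPG.H2.hess z))]
  rw [add_mul]
  exact h3.trans (add_le_add h1 h2)
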